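/- Let $f=(f_1,\dots,f_k)$ be any finite system of polynomials in $\mathbb{R}[x]=\mathbb{R}[x_1,\dots,x_n]$, and let $\mathcal{J}=(\partial f_i/\partial x_j)_{1\le i\le k,\,1\le j\le n}$ be its Jacobian matrix. Let $\mathfrak{a}=(\mathfrak{a}_1,\dots,\mathfrak{a}_n)$ and $\beta$ be further indeterminates. In $\mathbb{R}[x,\mathfrak{a},\beta]$ put $F=(F_1,\dots,F_n)=x-\mathfrak{a}+\beta\cdot\mathcal{J}^{t}\cdot f$, that is, $$F_i = x_i-\mathfrak{a}_i+\beta\sum_{l=1}^{k}\frac{\partial f_l}{\partial x_i}\,f_l\qquad(1\le i\le n),$$ and let $G=\{F_1,\dots,F_n,\ \det(\partial F/\partial x)\}\subset\mathbb{R}[x,\mathfrak{a},\beta]$, where $\partial F/\partial x=(\partial F_i/\partial x_j)_{1\le i,j\le n}$. Then the ideal $\langle G\rangle$ of $\mathbb{R}[x,\mathfrak{a},\beta]$ contains a nonzero polynomial $\phi(\mathfrak{a},\beta)\in\mathbb{R}[\mathfrak{a},\beta]$ in the parameters alone; that is, $\langle G\rangle\cap\mathbb{R}[\mathfrak{a},\beta]\neq\{0\}$.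 -/

import Mathlib

namespace PenaltySystem

/-- The variables of `ℝ[x, 𝔞, β]`, where `x = (x₁, …, xₙ)` are the unknowns and
`𝔞 = (𝔞₁, …, 𝔞ₙ)`, `β` are the parameters. The right summand `Fin n ⊕ Unit` indexes the variables
of the parameter ring `ℝ[𝔞, β]`. -/
abbrev Var (n : ℕ) : Type := Fin n ⊕ (Fin n ⊕ Unit)

/-- The variable `xᵢ` -/
abbrev xVar {n : ℕ} (i : Fin n) : Var n := Sum.inl i

/-- The parameter `𝔞ᵢ` -/
abbrev aVar {n : ℕ} (i : Fin n) : Var n := Sum.inr (Sum.inl i)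

/-- The parameter `β` -/
abbrev betaVar (n : ℕ) : Var n := Sum.inr (Sum.inr ())

/-- The inclusion `ℝ[x] → ℝ[x, 𝔞, β]` -/
noncomputable def ofX (n : ℕ) : MvPolynomial (Fin n) ℝ →ₐ[ℝ] MvPolynomial (Var n) ℝ :=
  MvPolynomial.rename Sum.inl

/-- The inclusion `ℝ[𝔞, β] → ℝ[x, 𝔞, β]` -/
noncomputable def ofParam (n : ℕ) :
    MvPolynomial (Fin n ⊕ Unit) ℝ →ₐ[ℝ] MvPolynomial (Var n) ℝ :=
  MvPolynomial.rename Sum.inr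

/-- The Jacobian matrix `𝒥 = (∂fᵢ/∂xⱼ)` of `f = (f₁, …, fₖ)`, of size `k × n`. -/
noncomputable def jacobian {n k : ℕ} (f : Fin k → MvPolynomial (Fin n) ℝ) :
    Matrix (Fin k) (Fin n) (MvPolynomial (Fin n) ℝ) :=
  Matrix.of fun i j => MvPolynomial.pderiv j (f i)

/-- The system `F = x - 𝔞 + β · 𝒥ᵗ · f` of `n` polynomials in `ℝ[x, 𝔞, β]`. -/
noncomputable def sysF {n k : ℕ} (f : Fin k → MvPolynomial (Fin n) ℝ) (i : Fin n) :
    MvPolynomial (Var n) ℝ :=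
  MvPolynomial.X (xVar i) - MvPolynomial.X (aVar i)
    + MvPolynomial.X (betaVar n) * ofX n (((jacobian f).transpose.mulVec f) i)

/-- The `n × n` matrix `∂F/∂x`. -/
noncomputable def dFdx {n k : ℕ} (f : Fin k → MvPolynomial (Fin n) ℝ) :
    Matrix (Fin n) (Fin n) (MvPolynomial (Var n) ℝ) :=
  Matrix.of fun i j => MvPolynomial.pderiv (xVar j) (sysF f i)

/-- The set `G = {F₁, …, Fₙ, det (∂F/∂x)}`. -/
noncomputable def sysG {n k : ℕ} (f : Fin k → MvPolynomial (Fin n) ℝ) :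
    Set (MvPolynomial (Var n) ℝ) :=
  Set.range (sysF f) ∪ {(dFdx f).det}

end PenaltySystem

/-!
The relations `F = 0` say `𝔞 = x + β · 𝒥ᵗ f(x)`, so modulo them a polynomial in the parameters
`(𝔞, β)` becomes its pullback along the endomorphism `(x, β) ↦ (x + β · 𝒥ᵗ f(x), β)` of affine
space, and `det (∂F/∂x)` is the Jacobian determinant `D` of that endomorphism. At the origin `D` is
`1`, hence `D ≠ 0`. Source and target have the same finite transcendence degree, so either the
pullback kills some `φ ≠ 0`, or `ℝ[x, β]` is algebraic over the pulled back parameter ring and `D`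
divides the pullback of some `φ ≠ 0`. Either way `φ(𝔞, β)` lies in the ideal.
-/

namespace PenaltySystem

open Cardinal MvPolynomial

section TranscendenceDegree

universe v w

variable {R : Type*} {A : Type v} {B : Type w} [CommRing R] [CommRing A] [CommRing B] [IsDomain B]
  [Algebra R A] [Algebra R B]

theorem isAlgebraic_of_lift_trdeg_le [Algebra A B] [IsScalarTower R A B] [FaithfulSMul R A]
    [FaithfulSMul A B] (hfin : Algebra.trdeg R A < ℵ₀)
    (hle : lift.{v} (Algebra.trdeg R B) ≤ lift.{w} (Algebra.trdeg R A)) :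
    Algebra.IsAlgebraic A B := by
  have : Nontrivial R := (algebraMap R B).domain_nontrivial
  have hadd := lift_trdeg_add_eq R A B
  have heq : lift.{v} (Algebra.trdeg R B) = lift.{w} (Algebra.trdeg R A) :=
    hle.antisymm (hadd ▸ self_le_add_right _ _)
  have hzero : lift.{v} (Algebra.trdeg A B) = 0 :=
    Cardinal.eq_of_add_eq_add_left (hadd.trans (heq.trans (add_zero _).symm))
      (lift_lt_aleph0.2 hfin)
  exact trdeg_eq_zero_iff.1 (lift_eq_zero.1 hzero)

theorem exists_ne_zero_dvd_map_of_lift_trdeg_le [FaithfulSMul R A] (θ : A →ₐ[R] B)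
    (hfin : Algebra.trdeg R A < ℵ₀)
    (hle : lift.{v} (Algebra.trdeg R B) ≤ lift.{w} (Algebra.trdeg R A)) {b : B} (hb : b ≠ 0) :
    ∃ a : A, a ≠ 0 ∧ b ∣ θ a := by
  by_cases hθ : Function.Injective θ
  · let : Algebra A B := θ.toRingHom.toAlgebra
    have : IsScalarTower R A B := .of_algebraMap_eq fun r => (θ.commutes r).symm
    have : FaithfulSMul A B := (faithfulSMul_iff_algebraMap_injective A B).2 hθ
    have hAB : Algebra.IsAlgebraic A B := isAlgebraic_of_lift_trdeg_le hfin hle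
    exact (hAB.isAlgebraic b).exists_nonzero_dvd (mem_nonZeroDivisors_of_ne_zero hb)
  · obtain ⟨a, ha, ha0⟩ : ∃ a, θ a = 0 ∧ a ≠ 0 := by
      simpa only [injective_iff_map_eq_zero, not_forall, exists_prop] using hθ
    exact ⟨a, ha0, ha ▸ dvd_zero b⟩

theorem exists_ne_zero_dvd_map_of_card_le {S σ τ : Type*} [CommRing S] [IsDomain S] [Finite σ]
    [Finite τ] (hcard : Nat.card τ ≤ Nat.card σ) (θ : MvPolynomial σ S →ₐ[S] MvPolynomial τ S)
    {q : MvPolynomial τ S} (hq : q ≠ 0) : ∃ p, p ≠ 0 ∧ q ∣ θ p := by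
  refine exists_ne_zero_dvd_map_of_lift_trdeg_le θ ?_ ?_ hq
  · simp [MvPolynomial.trdeg_of_isDomain]
  · simpa [MvPolynomial.trdeg_of_isDomain, ← Nat.cast_card] using hcard

end TranscendenceDegree

section Graph

variable {R ξ α τ : Type*} [CommRing R]

/-- The relation `hᵢ(x, t) - 𝔞ᵢ` in the coordinates `(x, 𝔞, t)`, indexed by `ξ ⊕ (α ⊕ τ)`. As `i`
varies, these relations cut out the graph of `h`. -/
noncomputable def graphRelation (h : α → MvPolynomial (ξ ⊕ τ) R) (i : α) :
    MvPolynomial (ξ ⊕ (α ⊕ τ)) R :=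
  rename (Sum.map id Sum.inr) (h i) - X (Sum.inr (Sum.inl i))

/-- The pullback of polynomials in `(𝔞, t)` along the parametrized map `(x, t) ↦ (h(x, t), t)`. -/
noncomputable def graphPullback (h : α → MvPolynomial (ξ ⊕ τ) R) :
    MvPolynomial (α ⊕ τ) R →ₐ[R] MvPolynomial (ξ ⊕ τ) R :=
  aeval (Sum.elim h (X ∘ Sum.inr))

theorem map_sub_map_mem_of_forall_X {σ S : Type*} [CommRing S] [Algebra R S] {I : Ideal S}
    {φ ψ : MvPolynomial σ R →ₐ[R] S} (hX : ∀ i, φ (X i) - ψ (X i) ∈ I) (p : MvPolynomial σ R) :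
    φ p - ψ p ∈ I := by
  have hcomp : (Ideal.Quotient.mkₐ R I).comp φ = (Ideal.Quotient.mkₐ R I).comp ψ :=
    algHom_ext fun i => Ideal.Quotient.eq.2 (hX i)
  exact Ideal.Quotient.eq.1 (DFunLike.congr_fun hcomp p)

theorem rename_graphPullback_sub_rename_mem_span (h : α → MvPolynomial (ξ ⊕ τ) R)
    (p : MvPolynomial (α ⊕ τ) R) :
    rename (Sum.map id Sum.inr) (graphPullback h p) - rename Sum.inr p ∈
      Ideal.span (Set.range (graphRelation h)) := by
  refine map_sub_map_mem_of_forall_X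
    (φ := (rename (Sum.map id Sum.inr)).comp (graphPullback h)) (ψ := rename Sum.inr) ?_ p
  rintro (i | t)
  · simpa [graphPullback, graphRelation] using
      Ideal.subset_span (Set.mem_range_self (f := graphRelation h) i)
  · simp [graphPullback]

theorem exists_ne_zero_rename_inr_mem_span_graphRelation [IsDomain R] [Finite ξ] [Finite α]
    [Finite τ] (hcard : Nat.card ξ ≤ Nat.card α) (h : α → MvPolynomial (ξ ⊕ τ) R)
    {q : MvPolynomial (ξ ⊕ τ) R} (hq : q ≠ 0) :
    ∃ p : MvPolynomial (α ⊕ τ) R, p ≠ 0 ∧ rename Sum.inr p ∈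
      Ideal.span (Set.range (graphRelation h) ∪ {rename (Sum.map id Sum.inr) q}) := by
  obtain ⟨p, hp, hdvd⟩ := exists_ne_zero_dvd_map_of_card_le
    (by simpa only [Nat.card_sum, add_le_add_iff_right] using hcard) (graphPullback h) hq
  refine ⟨p, hp, (Submodule.sub_mem_iff_right _ ?_).1
    (Ideal.span_mono Set.subset_union_left (rename_graphPullback_sub_rename_mem_span h p))⟩
  exact Ideal.mem_of_dvd _ (map_dvd _ hdvd) (Ideal.subset_span (Or.inr rfl))

theorem pderiv_inl_graphRelation (h : α → MvPolynomial (ξ ⊕ τ) R) (i : α) (j : ξ) :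
    pderiv (Sum.inl j) (graphRelation h i) =
      rename (Sum.map id Sum.inr) (pderiv (Sum.inl j) (h i)) := by
  have hinj : Function.Injective (Sum.map id Sum.inr : ξ ⊕ τ → ξ ⊕ (α ⊕ τ)) :=
    Function.injective_id.sumMap Sum.inr_injective
  rw [graphRelation, map_sub, pderiv_X_of_ne Sum.inr_ne_inl, sub_zero]
  exact pderiv_rename hinj (Sum.inl j) (h i)

end Graph

section Perturbation

variable {R σ : Type*} [CommRing R] (g : σ → MvPolynomial σ R)

/-- The family `x + β · g(x)`, a perturbation of the identity with parameter `β`, in the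
coordinates `(x, β)`. -/
noncomputable def perturbedId (i : σ) : MvPolynomial (σ ⊕ Unit) R :=
  X (Sum.inl i) + X (Sum.inr ()) * rename Sum.inl (g i)

/-- The system `x - 𝔞 + β · g(x)` in the coordinates `(x, 𝔞, β)`. For `g = 𝒥ᵗ · f` it is
definitionally the system `sysF f`. -/
noncomputable def perturbedSystem (i : σ) : MvPolynomial (σ ⊕ (σ ⊕ Unit)) R :=
  X (Sum.inl i) - X (Sum.inr (Sum.inl i)) + X (Sum.inr (Sum.inr ())) * rename Sum.inl (g i)

theorem graphRelation_perturbedId : graphRelation (perturbedId g) = perturbedSystem g := by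
  ext1 i
  have hinl : (Sum.map id Sum.inr ∘ Sum.inl : σ → σ ⊕ (σ ⊕ Unit)) = Sum.inl := rfl
  simp only [graphRelation, perturbedId, perturbedSystem, map_add, map_mul, rename_X, rename_rename,
    hinl, Sum.map_inl, Sum.map_inr, id_eq]
  ring

variable [Fintype σ] [DecidableEq σ]

theorem constantCoeff_det_pderiv_perturbedId :
    constantCoeff (Matrix.of fun i j => pderiv (Sum.inl j) (perturbedId g i)).det = 1 := by
  have hone : constantCoeff.mapMatrix
      (Matrix.of fun i j => pderiv (Sum.inl j) (perturbedId g i)) = 1 := by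
    ext i j
    simp [perturbedId, pderiv_X, Matrix.one_apply, Pi.single_apply, apply_ite constantCoeff]
  rw [RingHom.map_det, hone, Matrix.det_one]

theorem det_pderiv_perturbedSystem :
    (Matrix.of fun i j => pderiv (Sum.inl j) (perturbedSystem g i)).det =
      rename (Sum.map id Sum.inr)
        (Matrix.of fun i j => pderiv (Sum.inl j) (perturbedId g i)).det := by
  rw [AlgHom.map_det, ← graphRelation_perturbedId]
  congr 1
  ext1 i j
  exact pderiv_inl_graphRelation _ i j

end Perturbation

end PenaltySystem

open MvPolynomial PenaltySystem in
theorem mainTheorem5_general {R σ : Type*} [CommRing R] [IsDomain R] [Fintype σ] [DecidableEq σ]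
    (g : σ → MvPolynomial σ R) :
    ∃ φ : MvPolynomial (σ ⊕ Unit) R, φ ≠ 0 ∧ rename Sum.inr φ ∈
      Ideal.span (Set.range (perturbedSystem g) ∪
        {(Matrix.of fun i j => pderiv (Sum.inl j) (perturbedSystem g i)).det}) := by
  have hdet : (Matrix.of fun i j => pderiv (Sum.inl j) (perturbedId g i)).det ≠ 0 := fun h =>
    zero_ne_one (by simpa only [h, map_zero] using constantCoeff_det_pderiv_perturbedId g)
  rw [det_pderiv_perturbedSystem, ← graphRelation_perturbedId]
  exact exists_ne_zero_rename_inr_mem_span_graphRelation le_rfl (perturbedId g) hdet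

theorem mainTheorem5 (n k : ℕ) (f : Fin k → MvPolynomial (Fin n) ℝ) :
    ∃ φ : MvPolynomial (Fin n ⊕ Unit) ℝ,
      φ ≠ 0 ∧ PenaltySystem.ofParam n φ ∈ Ideal.span (PenaltySystem.sysG f) :=
  mainTheorem5_general ((PenaltySystem.jacobian f).transpose.mulVec f)
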